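/- Let $\mathbb{T}=\mathbb{R}/\mathbb{Z}$, write $\langle x\rangle = x+\mathbb{Z}\in\mathbb{T}$ for $x\in\mathbb{R}$, and let $\lambda_{\mathbb{T}^d}$ denote the normalized Haar measure on $\mathbb{T}^d=\mathbb{R}^d/\mathbb{Z}^d$ (and $\lambda_{\mathbb{T}}=\lambda_{\mathbb{T}^1}$). Use the convention $\ln 0=0$. For integers $p_1,\dots,p_d$, $\beta\in\mathbb{R}$ and $u\in\mathbb{R}^d$ let $$\Lambda_u:\mathbb{T}^d\to\mathbb{T},\qquad \Lambda_u(t)=\Bigl\langle p_1t_1+\dots+p_dt_d+\beta\ln\bigl|u_1\cos(2\pi t_1)+\dots+u_d\cos(2\pi t_d)\bigr|\Bigr\rangle .$$ Theorem. For every integer $d\ge 1$, all $p_1,\dots,p_d\in\mathbb{Z}$ and every $\beta\in\mathbb{R}\setminus\{0\}$ there exists $u\in\mathbb{R}^d$ such that the push-forward measure satisfies $\lambda_{\mathbb{T}^d}\circ\Lambda_u^{-1}\neq\lambda_{\mathbb{T}}$. -/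

import Mathlib

open MeasureTheory

/-- The function `⟨x⟩ ↦ cos (2 π x)` on the circle `𝕋 = ℝ / ℤ`. -/
noncomputable def circleCos : UnitAddCircle → ℝ :=
  Function.Periodic.lift (f := fun x : ℝ => Real.cos (2 * Real.pi * x)) (c := 1) (by
    intro x
    simp only [mul_add, mul_one, Real.cos_add_two_pi])

theorem circleCos_coe (x : ℝ) :
    circleCos (x : UnitAddCircle) = Real.cos (2 * Real.pi * x) := rfl

/-- The map `Λ_u : 𝕋^d → 𝕋`,
`t ↦ ⟨p₁ t₁ + … + p_d t_d + β ln |u₁ cos (2 π t₁) + … + u_d cos (2 π t_d)|⟩`,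
with the convention `ln 0 = 0` (which is also that of `Real.log`). -/
noncomputable def logCosMap {d : ℕ} (p : Fin d → ℤ) (β : ℝ) (u : Fin d → ℝ)
    (t : UnitAddTorus (Fin d)) : UnitAddCircle :=
  ∑ j, p j • t j + ((β * Real.log |∑ j, u j * circleCos (t j)| : ℝ) : UnitAddCircle)

/-- On representatives `x ∈ ℝ^d` of points of `𝕋^d = ℝ^d / ℤ^d`, the map is given by
the expected formula. -/
theorem logCosMap_coe {d : ℕ} (p : Fin d → ℤ) (β : ℝ) (u x : Fin d → ℝ) :
    logCosMap p β u (fun j => (x j : UnitAddCircle)) =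
      ((∑ j, (p j : ℝ) * x j +
        β * Real.log |∑ j, u j * Real.cos (2 * Real.pi * x j)| : ℝ) : UnitAddCircle) := by
  have h : ((∑ j, (p j : ℝ) * x j : ℝ) : UnitAddCircle) =
      ∑ j, p j • (x j : UnitAddCircle) := by
    have := map_sum (QuotientAddGroup.mk' (AddSubgroup.zmultiples (1 : ℝ)))
      (fun j => (p j : ℝ) * x j) Finset.univ
    refine this.trans (Finset.sum_congr rfl fun j _ => ?_)
    rw [← zsmul_eq_mul, map_zsmul]
    rfl
  simp only [logCosMap, circleCos_coe, AddCircle.coe_add, h]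

theorem continuous_circleCos : Continuous circleCos :=
  continuous_coinduced_dom.mpr (by
    change Continuous fun x : ℝ => Real.cos (2 * Real.pi * x)
    fun_prop)

/-- `Λ_u` is Borel measurable, so its push-forward of a measure is the genuine one. -/
theorem measurable_logCosMap {d : ℕ} (p : Fin d → ℤ) (β : ℝ) (u : Fin d → ℝ) :
    Measurable (logCosMap p β u) := by
  have h1 : Continuous fun t : UnitAddTorus (Fin d) => ∑ j, p j • t j := by fun_prop
  have h2 : Continuous fun t : UnitAddTorus (Fin d) => |∑ j, u j * circleCos (t j)| := by
    have := continuous_circleCos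
    fun_prop
  have h3 : Continuous fun x : ℝ => (x : UnitAddCircle) := AddCircle.continuous_mk' 1
  exact h1.measurable.add
    (h3.measurable.comp ((Real.measurable_log.comp h2.measurable).const_mul β))

/-! If every `u` gave Haar measure, the second Fourier coefficient of the push-forward would vanish:
the integral of `∏ e(2 p_j t_j) · |∑ u_j cos 2πt_j|^w` over the torus would be zero for all `u`,
with `w = 4πβi`. Taking the `u_j` to be the moduli of complex numbers `z_j` and averaging over a
Gaussian on `ℂ^d` turns this into the vanishing of `∫ ∏ z_j^(2|p_j|) |∑ Re z_j|^w`
(`integral_pi_gaussianComplex_eq_zero_of_forall`).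

This Gaussian integral is in fact nonzero. Real rotations of `ℂ^d` and the mean value property of
polynomials reduce it to a nonzero multiple of `∫ z^(2k) |Re z|^w` over `ℂ`, with `k = ∑ |p_j|`
(`exists_integral_pi_gaussianComplex_eq`). In polar coordinates that is a Gamma value times a
Fourier coefficient of `|cos θ|^w`, and a two-step recurrence shows that the even coefficients do
not vanish (`absCosCoeff_even_ne_zero`). -/

/-! ### The Gaussian on `ℂ` and its symmetries -/

/-- The measure on `ℂ` with density `exp (-‖z‖ ^ 2)`. -/
noncomputable def gaussianComplex : Measure ℂ :=
  volume.withDensity fun z => ENNReal.ofReal (Real.exp (-‖z‖ ^ 2))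

theorem integral_gaussianComplex (f : ℂ → ℂ) :
    ∫ z, f z ∂gaussianComplex = ∫ z : ℂ, f z * Real.exp (-‖z‖ ^ 2) := by
  rw [gaussianComplex, integral_withDensity_eq_integral_toReal_smul (by fun_prop) (by simp)]
  refine integral_congr_ae (Filter.Eventually.of_forall fun z => ?_)
  simp only [ENNReal.toReal_ofReal (Real.exp_pos _).le, Complex.real_smul]
  ring

theorem integrable_norm_pow_gaussianComplex (n : ℕ) :
    Integrable (fun z : ℂ => ‖z‖ ^ n) gaussianComplex := by
  rw [gaussianComplex, integrable_withDensity_iff_integrable_smul' (by fun_prop) (by simp)]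
  have h := Complex.integral_rpow_mul_exp_neg_rpow (p := 2) (q := n) (by norm_num)
    (by have : (0 : ℝ) ≤ n := n.cast_nonneg
        linarith)
  have h' : Integrable fun z : ℂ => ‖z‖ ^ (n : ℝ) * Real.exp (-‖z‖ ^ (2 : ℝ)) := by
    -- A non-integrable function would have integral zero, but the Gamma formula gives a positive
    -- value.
    by_contra hc
    rw [integral_undef hc] at h
    have : 0 < Real.Gamma ((n + 2 : ℝ) / 2) := Real.Gamma_pos_of_pos (by positivity)
    have := Real.pi_pos
    have : 0 < (2 * Real.pi / 2) * Real.Gamma ((n + 2 : ℝ) / 2) := by positivity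
    linarith
  refine h'.congr (Filter.Eventually.of_forall fun z => ?_)
  simp only [ENNReal.toReal_ofReal (Real.exp_pos _).le, smul_eq_mul, Real.rpow_natCast,
    Real.rpow_ofNat]
  ring

instance : IsFiniteMeasure gaussianComplex := by
  have := integrable_norm_pow_gaussianComplex 0
  simpa [integrable_const_iff, isFiniteMeasure_iff] using this

theorem gaussianComplex_real_univ_ne_zero : gaussianComplex.real Set.univ ≠ 0 := by
  rw [measureReal_ne_zero_iff, Measure.measure_univ_ne_zero, gaussianComplex]
  intro h
  rw [withDensity_eq_zero_iff (by fun_prop)] at h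
  have h2 : ∀ᵐ z : ℂ, False := h.mono fun z hz => by
    simp only [Pi.zero_apply, ENNReal.ofReal_eq_zero] at hz
    exact absurd hz (not_le.mpr (Real.exp_pos _))
  exact NeZero.ne (volume : Measure ℂ) (by simpa using h2)

theorem MeasureTheory.MeasurePreserving.withDensity_of_comp_eq {α : Type*} [MeasurableSpace α]
    {μ : Measure α} {e : α → α} (he : MeasurePreserving e μ μ) {f : α → ENNReal}
    (hf : Measurable f) (hfe : ∀ x, f (e x) = f x) :
    MeasurePreserving e (μ.withDensity f) (μ.withDensity f) := by
  refine ⟨he.measurable, ?_⟩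
  ext s hs
  rw [Measure.map_apply he.measurable hs, withDensity_apply _ (he.measurable hs),
    withDensity_apply _ hs, ← he.setLIntegral_comp_preimage hs hf]
  simp only [hfe]

theorem measurePreserving_mul_gaussianComplex (c : Circle) :
    MeasurePreserving (fun z : ℂ => c * z) gaussianComplex gaussianComplex := by
  refine MeasurePreserving.withDensity_of_comp_eq
    (rotation c).measurePreserving (by fun_prop) fun z => ?_
  rw [LinearIsometryEquiv.norm_map]

theorem measurePreserving_rotation_prod_gaussianComplex {a b : ℝ} (hab : a ^ 2 + b ^ 2 = 1) :
    MeasurePreserving (fun p : ℂ × ℂ => ((a * p.1 - b * p.2, b * p.1 + a * p.2) : ℂ × ℂ))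
      (gaussianComplex.prod gaussianComplex) (gaussianComplex.prod gaussianComplex) := by
  have habc : (a : ℂ) ^ 2 + (b : ℂ) ^ 2 = 1 := by exact_mod_cast hab
  have hnorm (p : ℂ × ℂ) : ‖a * p.1 - b * p.2‖ ^ 2 + ‖b * p.1 + a * p.2‖ ^ 2
      = ‖p.1‖ ^ 2 + ‖p.2‖ ^ 2 := by
    simp only [← Complex.normSq_eq_norm_sq, Complex.normSq_apply, Complex.sub_re, Complex.sub_im,
      Complex.add_re, Complex.add_im, Complex.re_ofReal_mul, Complex.im_ofReal_mul]
    linear_combination (p.1.re ^ 2 + p.1.im ^ 2 + p.2.re ^ 2 + p.2.im ^ 2) * hab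
  rw [gaussianComplex, prod_withDensity (by fun_prop) (by fun_prop)]
  refine MeasurePreserving.withDensity_of_comp_eq ?_ (by fun_prop) fun p => ?_
  -- The product carries the sup norm, so the rotation is an isometry only after passing to the `L²`
  -- norm.
  · let l : WithLp 2 (ℂ × ℂ) →ₗ[ℝ] WithLp 2 (ℂ × ℂ) :=
      { toFun := fun p => WithLp.toLp 2 (a * p.fst - b * p.snd, b * p.fst + a * p.snd)
        map_add' := fun p q => by
          refine WithLp.ofLp_injective 2 (Prod.ext ?_ ?_) <;> simp <;> ring
        map_smul' := fun r p => by
          refine WithLp.ofLp_injective 2 (Prod.ext ?_ ?_) <;> simp <;> ring }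
    let li : WithLp 2 (ℂ × ℂ) →ₗᵢ[ℝ] WithLp 2 (ℂ × ℂ) :=
      { l with
        norm_map' := fun p => by
          rw [WithLp.prod_norm_eq_of_L2, WithLp.prod_norm_eq_of_L2]
          exact congrArg Real.sqrt (hnorm (p.fst, p.snd)) }
    have h := (li.toLinearIsometryEquiv rfl).measurePreserving
    exact (WithLp.volume_preserving_ofLp ℂ ℂ).comp (h.comp (WithLp.volume_preserving_toLp ℂ ℂ))
  · rw [← ENNReal.ofReal_mul (Real.exp_pos _).le, ← ENNReal.ofReal_mul (Real.exp_pos _).le,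
      ← Real.exp_add, ← Real.exp_add, ← neg_add, ← neg_add, hnorm]

/-! ### Polynomial moments and the mean value property -/

theorem integrable_gaussianComplex_of_norm_le {f : ℂ → ℂ} (hf : Measurable f) {C : ℝ} {n : ℕ}
    (h : ∀ z, ‖f z‖ ≤ C * ‖z‖ ^ n) : Integrable f gaussianComplex :=
  ((integrable_norm_pow_gaussianComplex n).const_mul C).mono' hf.aestronglyMeasurable
    (Filter.Eventually.of_forall h)

theorem integrable_pow_gaussianComplex (n : ℕ) :
    Integrable (fun z : ℂ => z ^ n) gaussianComplex :=
  integrable_gaussianComplex_of_norm_le (C := 1) (n := n) (by fun_prop) (by simp)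

theorem integral_pow_gaussianComplex {n : ℕ} (hn : n ≠ 0) :
    ∫ z, z ^ n ∂gaussianComplex = 0 := by
  -- Rotation by an `n`-th root of `-1` preserves the measure and negates the integrand.
  let c : Circle := Circle.exp (Real.pi / n)
  have hc : (c : ℂ) ^ n = -1 := by
    have : (n : ℂ) ≠ 0 := by exact_mod_cast hn
    rw [Circle.coe_exp, ← Complex.exp_nat_mul, ← Complex.exp_pi_mul_I]
    congr 1
    push_cast
    field_simp
  have h := (measurePreserving_mul_gaussianComplex c).integral_comp
    (rotation c).toHomeomorph.measurableEmbedding (fun z : ℂ => z ^ n)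
  simp only [mul_pow, hc, neg_mul, one_mul, integral_neg] at h
  exact self_eq_neg.mp h.symm

theorem Polynomial.integrable_eval_gaussianComplex (P : Polynomial ℂ) :
    Integrable (fun z => P.eval z) gaussianComplex := by
  induction P using Polynomial.induction_on' with
  | add p q hp hq => simpa [Pi.add_def] using hp.add hq
  | monomial n a => simpa using (integrable_pow_gaussianComplex n).const_mul a

theorem Polynomial.integral_eval_gaussianComplex (P : Polynomial ℂ) :
    ∫ z, P.eval z ∂gaussianComplex = gaussianComplex.real Set.univ * P.eval 0 := by
  induction P using Polynomial.induction_on' with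
  | add p q hp hq =>
    simp only [Polynomial.eval_add]
    rw [integral_add p.integrable_eval_gaussianComplex q.integrable_eval_gaussianComplex, hp, hq,
      mul_add]
  | monomial n a =>
    simp only [Polynomial.eval_monomial, integral_const_mul]
    rcases eq_or_ne n 0 with rfl | hn
    · simp [mul_comm]
    · simp [integral_pow_gaussianComplex hn, hn]

/-- In rotated coordinates `(z, y)` the argument of `g` is `Re z` alone, and the rest is the
polynomial `(az - by)^n (bz + ay)^m` in `y`. By the mean value property, integrating over `y`
evaluates it at `y = 0`. -/
theorem integral_prod_gaussianComplex_pow_mul_pow {a b : ℝ} (hab : a ^ 2 + b ^ 2 = 1) (n m : ℕ)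
    {g : ℝ → ℂ} (hg : Measurable g) {C : ℝ} (hC : ∀ x, ‖g x‖ ≤ C) :
    ∫ p : ℂ × ℂ, p.1 ^ n * p.2 ^ m * g (a * p.1.re + b * p.2.re)
        ∂gaussianComplex.prod gaussianComplex
      = gaussianComplex.real Set.univ * a ^ n * b ^ m *
        ∫ z, z ^ (n + m) * g z.re ∂gaussianComplex := by
  have hmp := measurePreserving_rotation_prod_gaussianComplex hab
  have hint : Integrable
      (fun p : ℂ × ℂ => p.1 ^ n * p.2 ^ m * g (a * p.1.re + b * p.2.re))
      (gaussianComplex.prod gaussianComplex) := by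
    refine Integrable.mul_bdd (c := C)
      ((integrable_pow_gaussianComplex n).mul_prod (integrable_pow_gaussianComplex m))
      (Measurable.aestronglyMeasurable (by fun_prop)) (Filter.Eventually.of_forall fun p => hC _)
  have hre (p : ℂ × ℂ) : a * (a * p.1 - b * p.2).re + b * (b * p.1 + a * p.2).re = p.1.re := by
    simp only [Complex.sub_re, Complex.add_re, Complex.re_ofReal_mul]
    linear_combination p.1.re * hab
  have hint' := hmp.integrable_comp_of_integrable hint
  simp only [Function.comp_def, hre] at hint'
  have hmap := integral_map hmp.measurable.aemeasurable (μ := gaussianComplex.prod gaussianComplex)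
    (f := fun p : ℂ × ℂ => p.1 ^ n * p.2 ^ m * g (a * p.1.re + b * p.2.re))
    (Measurable.aestronglyMeasurable (by fun_prop))
  rw [hmp.map_eq] at hmap
  simp only [hre] at hmap
  rw [hmap, integral_prod _ hint', ← integral_const_mul]
  refine integral_congr_ae (Filter.Eventually.of_forall fun z => ?_)
  have hP := Polynomial.integral_eval_gaussianComplex
    ((Polynomial.C (a * z) - Polynomial.C (b : ℂ) * Polynomial.X) ^ n *
      (Polynomial.C (b * z) + Polynomial.C (a : ℂ) * Polynomial.X) ^ m)
  simp only [Polynomial.eval_mul, Polynomial.eval_pow, Polynomial.eval_sub, Polynomial.eval_add,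
    Polynomial.eval_C, Polynomial.eval_X, mul_zero, sub_zero, add_zero] at hP
  simp only [integral_mul_const, hP]
  ring

/-! ### Imaginary powers of `|x|` and their Gaussian integrals -/

theorem norm_ofReal_abs_cpow_le {w : ℂ} (hw : w.re = 0) (x : ℝ) : ‖((|x| : ℝ) : ℂ) ^ w‖ ≤ 1 := by
  rcases eq_or_ne x 0 with rfl | hx
  · rcases eq_or_ne w 0 with rfl | hw0
    · simp
    · simp [Complex.zero_cpow hw0]
  · rw [Complex.norm_cpow_eq_rpow_re_of_pos (abs_pos.mpr hx), hw, Real.rpow_zero]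

theorem measurable_ofReal_abs_cpow (w : ℂ) : Measurable fun x : ℝ => ((|x| : ℝ) : ℂ) ^ w := by
  fun_prop

theorem hasDerivAt_mul_ofReal_abs_cpow {w : ℂ} (hw : w + 1 ≠ 0) {x : ℝ} (hx : x ≠ 0) :
    HasDerivAt (fun y : ℝ => (y : ℂ) * ((|y| : ℝ) : ℂ) ^ w) ((1 + w) * ((|x| : ℝ) : ℂ) ^ w) x := by
  rcases lt_or_gt_of_ne hx with h | h
  · have h1 := (hasDerivAt_ofReal_cpow_const (neg_ne_zero.mpr hx) hw).scomp x (hasDerivAt_neg x)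
    have h2 := h1.neg
    rw [abs_of_neg h]
    refine (h2.congr_deriv ?_).congr_of_eventuallyEq ?_
    · simp only [add_sub_cancel_right, neg_smul, one_smul, neg_neg]
      ring
    · filter_upwards [eventually_lt_nhds h] with y hy
      have : ((-y : ℝ) : ℂ) ≠ 0 := by exact_mod_cast (neg_pos.mpr hy).ne'
      simp only [Pi.neg_apply, Function.comp_apply]
      rw [abs_of_neg hy, Complex.cpow_add _ _ this, Complex.cpow_one]
      push_cast
      ring
  · rw [abs_of_pos h]
    refine ((hasDerivAt_ofReal_cpow_const hx hw).congr_deriv ?_).congr_of_eventuallyEq ?_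
    · rw [add_sub_cancel_right, add_comm]
    · filter_upwards [eventually_gt_nhds h] with y hy
      have : (y : ℂ) ≠ 0 := by exact_mod_cast hy.ne'
      rw [abs_of_pos hy, Complex.cpow_add _ _ this, Complex.cpow_one, mul_comm]

theorem continuous_mul_ofReal_abs_cpow {w : ℂ} (hw : w.re = 0) :
    Continuous fun y : ℝ => (y : ℂ) * ((|y| : ℝ) : ℂ) ^ w := by
  rw [continuous_iff_continuousAt]
  intro x
  rcases eq_or_ne x 0 with rfl | hx
  · rw [ContinuousAt, Complex.ofReal_zero, zero_mul]
    refine squeeze_zero_norm (a := fun y : ℝ => |y|) (fun y => ?_) ?_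
    · rw [norm_mul, Complex.norm_real, Real.norm_eq_abs]
      exact mul_le_of_le_one_right (abs_nonneg y) (norm_ofReal_abs_cpow_le hw y)
    · simpa using (continuous_abs (G := ℝ)).tendsto 0
  · refine (hasDerivAt_mul_ofReal_abs_cpow (fun h => ?_) hx).continuousAt
    simpa [hw] using congrArg Complex.re h

/-- The substitution `x ↦ x²` in the Mellin integral for Gamma. -/
theorem integral_cpow_mul_exp_neg_sq {w : ℂ} (hw : 0 < w.re) :
    ∫ x : ℝ in Set.Ioi 0, (x : ℂ) ^ (w - 1) * Real.exp (-x ^ 2) = Complex.Gamma (w / 2) / 2 := by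
  have h := mellin_comp_rpow (fun x => ((Real.exp (-x) : ℝ) : ℂ)) w 2
  rw [← Complex.GammaIntegral_eq_mellin, Complex.ofReal_ofNat,
    ← Complex.Gamma_eq_integral (by simpa using hw), mellin] at h
  simp only [Real.rpow_ofNat, smul_eq_mul, Complex.real_smul] at h
  rw [h]
  norm_num
  ring

theorem integral_cpow_mul_exp_neg_sq_ne_zero {w : ℂ} (hw : 0 < w.re) :
    ∫ x : ℝ in Set.Ioi 0, (x : ℂ) ^ (w - 1) * Real.exp (-x ^ 2) ≠ 0 := by
  rw [integral_cpow_mul_exp_neg_sq hw]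
  exact div_ne_zero (Complex.Gamma_ne_zero_of_re_pos (by simpa using hw)) two_ne_zero

theorem integral_abs_cpow_mul_exp_neg_sq_ne_zero {w : ℂ} (hw : w.re = 0) :
    ∫ x : ℝ, ((|x| : ℝ) : ℂ) ^ w * Real.exp (-x ^ 2) ≠ 0 := by
  have hint : Integrable fun x : ℝ => ((|x| : ℝ) : ℂ) ^ w * Real.exp (-x ^ 2) := by
    refine Integrable.bdd_mul (c := 1) ?_ (measurable_ofReal_abs_cpow w).aestronglyMeasurable
      (Filter.Eventually.of_forall fun x => norm_ofReal_abs_cpow_le hw x)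
    simpa using (integrable_exp_neg_mul_sq one_pos).ofReal (𝕜 := ℂ)
  have hIoi : ∫ x : ℝ in Set.Ioi 0, ((|x| : ℝ) : ℂ) ^ w * Real.exp (-x ^ 2)
      = ∫ x : ℝ in Set.Ioi 0, (x : ℂ) ^ (w + 1 - 1) * Real.exp (-x ^ 2) := by
    refine setIntegral_congr_fun measurableSet_Ioi fun x hx => ?_
    simp only [abs_of_pos (Set.mem_Ioi.mp hx), add_sub_cancel_right]
  have hIic := integral_comp_neg_Iic 0 fun x : ℝ => ((|x| : ℝ) : ℂ) ^ w * Real.exp (-x ^ 2)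
  simp only [abs_neg, neg_sq, neg_zero] at hIic
  rw [← intervalIntegral.integral_Iic_add_Ioi hint.integrableOn hint.integrableOn (b := 0), hIic,
    hIoi, ← two_mul]
  exact mul_ne_zero two_ne_zero (integral_cpow_mul_exp_neg_sq_ne_zero (by simp [hw]))

theorem integral_gaussianComplex_abs_re_cpow_ne_zero {w : ℂ} (hw : w.re = 0) :
    ∫ z, ((|z.re| : ℝ) : ℂ) ^ w ∂gaussianComplex ≠ 0 := by
  have h : ∫ z, ((|z.re| : ℝ) : ℂ) ^ w ∂gaussianComplex
      = (∫ x : ℝ, ((|x| : ℝ) : ℂ) ^ w * Real.exp (-x ^ 2)) * ∫ y : ℝ, (Real.exp (-y ^ 2) : ℂ) := by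
    rw [integral_gaussianComplex, ← integral_prod_mul, ← Measure.volume_eq_prod,
      ← Complex.volume_preserving_equiv_real_prod.integral_comp
        Complex.measurableEquivRealProd.measurableEmbedding]
    refine integral_congr_ae (Filter.Eventually.of_forall fun z => ?_)
    simp only [Complex.measurableEquivRealProd_apply, ← Complex.normSq_eq_norm_sq,
      Complex.normSq_apply]
    rw [mul_assoc, ← Complex.ofReal_mul, ← Real.exp_add]
    ring_nf
  rw [h]
  refine mul_ne_zero (integral_abs_cpow_mul_exp_neg_sq_ne_zero hw) ?_
  rw [integral_complex_ofReal, Complex.ofReal_ne_zero]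
  have := integral_gaussian 1
  simp only [neg_mul, one_mul, div_one] at this
  rw [this]
  positivity

/-! ### Fourier coefficients of `|cos θ|^w` -/

/-- The integral of `exp (N i θ) |cos θ| ^ w` over `[-π, π]`. -/
noncomputable def absCosCoeff (w : ℂ) (N : ℤ) : ℂ :=
  ∫ θ in -Real.pi..Real.pi, Complex.exp (N * Complex.I * θ) * ((|Real.cos θ| : ℝ) : ℂ) ^ w

theorem intervalIntegrable_exp_mul_abs_cos_cpow {w : ℂ} (hw : w.re = 0) (N : ℤ) (a b : ℝ) :
    IntervalIntegrable (fun θ : ℝ => Complex.exp (N * Complex.I * θ) * ((|Real.cos θ| : ℝ) : ℂ) ^ w)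
      volume a b := by
  refine (intervalIntegrable_const (c := (1 : ℝ))).mono_fun' (by fun_prop)
    (Filter.Eventually.of_forall fun θ => ?_)
  have : (N * Complex.I * θ : ℂ) = ((N * θ : ℝ) : ℂ) * Complex.I := by push_cast; ring
  beta_reduce
  rw [norm_mul, this, Complex.norm_exp_ofReal_mul_I, one_mul]
  exact norm_ofReal_abs_cpow_le hw _

/-- The derivative of `e^(iMθ) cos θ |cos θ|^w` integrates to zero over a period. The extra factor
`cos θ` keeps the function continuous at the zeros of the cosine, so differentiability off a
countable set suffices. -/
theorem absCosCoeff_recurrence {w : ℂ} (hw : w.re = 0) (M : ℤ) :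
    (M + 1 + w) * absCosCoeff w (M + 1) = (1 + w - M) * absCosCoeff w (M - 1) := by
  have hw1 : w + 1 ≠ 0 := fun h => by simpa [hw] using congrArg Complex.re h
  let F : ℝ → ℂ := fun θ => Complex.exp (M * Complex.I * θ) *
    ((Real.cos θ : ℂ) * ((|Real.cos θ| : ℝ) : ℂ) ^ w)
  let F' : ℝ → ℂ := fun θ => Complex.I / 2 *
    ((M + 1 + w) * (Complex.exp ((M + 1 : ℤ) * Complex.I * θ) * ((|Real.cos θ| : ℝ) : ℂ) ^ w) -
      (1 + w - M) * (Complex.exp ((M - 1 : ℤ) * Complex.I * θ) * ((|Real.cos θ| : ℝ) : ℂ) ^ w))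
  have hcount : {θ : ℝ | Real.cos θ = 0}.Countable := by
    refine (Set.countable_range fun k : ℤ => (2 * k + 1) * Real.pi / 2).mono fun θ hθ => ?_
    obtain ⟨k, hk⟩ := Real.cos_eq_zero_iff.mp hθ
    exact ⟨k, hk.symm⟩
  have hcont : Continuous F :=
    (by fun_prop : Continuous fun θ : ℝ => Complex.exp (M * Complex.I * θ)).mul
      ((continuous_mul_ofReal_abs_cpow hw).comp Real.continuous_cos)
  have hderiv : ∀ θ : ℝ, Real.cos θ ≠ 0 → HasDerivAt F (F' θ) θ := fun θ hθ => by
    have h1 : HasDerivAt (fun θ : ℝ => Complex.exp (M * Complex.I * θ))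
        (Complex.exp (M * Complex.I * θ) * (M * Complex.I * 1)) θ :=
      ((Complex.ofRealCLM.hasDerivAt (x := θ)).const_mul (M * Complex.I)).cexp
    have h2 := (hasDerivAt_mul_ofReal_abs_cpow hw1 hθ).scomp θ (Real.hasDerivAt_cos θ)
    refine (h1.mul h2).congr_deriv ?_
    have e1 : Complex.exp ((M + 1 : ℤ) * Complex.I * θ)
        = Complex.exp (M * Complex.I * θ) * (Real.cos θ + Real.sin θ * Complex.I) := by
      rw [Complex.ofReal_cos, Complex.ofReal_sin, ← Complex.exp_mul_I, ← Complex.exp_add]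
      push_cast
      ring_nf
    have e2 : Complex.exp ((M - 1 : ℤ) * Complex.I * θ)
        = Complex.exp (M * Complex.I * θ) * (Real.cos θ - Real.sin θ * Complex.I) := by
      have : Complex.exp (-θ * Complex.I) = Real.cos θ - Real.sin θ * Complex.I := by
        rw [Complex.exp_mul_I, Complex.cos_neg, Complex.sin_neg, Complex.ofReal_cos,
          Complex.ofReal_sin]
        ring
      rw [← this, ← Complex.exp_add]
      push_cast
      ring_nf
    simp only [F', e1, e2, Function.comp_apply, Complex.real_smul, Complex.ofReal_neg]
    linear_combination Complex.exp (M * Complex.I * θ) * ((|Real.cos θ| : ℝ) : ℂ) ^ w * (1 + w) *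
      Real.sin θ * (-Complex.I_sq)
  have hi1 := intervalIntegrable_exp_mul_abs_cos_cpow hw (M + 1) (-Real.pi) Real.pi
  have hi2 := intervalIntegrable_exp_mul_abs_cos_cpow hw (M - 1) (-Real.pi) Real.pi
  have hint : IntervalIntegrable F' volume (-Real.pi) Real.pi :=
    ((hi1.const_mul _).sub (hi2.const_mul _)).const_mul _
  have hper : F Real.pi = F (-Real.pi) := by
    have : Complex.exp (M * Complex.I * Real.pi) = Complex.exp (M * Complex.I * (-Real.pi : ℝ)) := by
      rw [Complex.exp_eq_exp_iff_exists_int]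
      refine ⟨M, ?_⟩
      push_cast
      ring
    simp only [F, this, Real.cos_neg]
  have h := integral_eq_of_hasDerivAt_off_countable F F' hcount hcont.continuousOn
    (fun θ hθ => hderiv θ hθ.2) hint
  rw [hper, sub_self, intervalIntegral.integral_const_mul,
    intervalIntegral.integral_sub (hi1.const_mul _) (hi2.const_mul _),
    intervalIntegral.integral_const_mul, intervalIntegral.integral_const_mul] at h
  exact sub_eq_zero.mp ((mul_eq_zero.mp h).resolve_left (by simp))

/-- Polar coordinates separate the variables; the Jacobian makes the radial exponent `N + 1 + w`. -/
theorem integral_gaussianComplex_pow_mul_abs_re_cpow (w : ℂ) (N : ℕ) :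
    ∫ z, z ^ N * ((|z.re| : ℝ) : ℂ) ^ w ∂gaussianComplex
      = (∫ r : ℝ in Set.Ioi 0, (r : ℂ) ^ ((N + 2 + w : ℂ) - 1) * Real.exp (-r ^ 2)) *
        absCosCoeff w N := by
  rw [integral_gaussianComplex, ← Complex.integral_comp_polarCoord_symm, absCosCoeff,
    intervalIntegral.integral_of_le (by linarith [Real.pi_pos]), integral_Ioc_eq_integral_Ioo,
    ← setIntegral_prod_mul, ← Measure.volume_eq_prod]
  refine setIntegral_congr_fun polarCoord.open_target.measurableSet fun p hp => ?_
  have hr : 0 < p.1 := hp.1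
  have hr' : (p.1 : ℂ) ≠ 0 := by exact_mod_cast hr.ne'
  have hre : (Complex.polarCoord.symm p).re = p.1 * Real.cos p.2 := by
    simp [Complex.polarCoord_symm_apply, - Complex.ofReal_cos]
  have hpow : Complex.polarCoord.symm p ^ N
      = (p.1 : ℂ) ^ N * Complex.exp ((N : ℤ) * Complex.I * p.2) := by
    rw [Complex.polarCoord_symm_apply, mul_pow, Complex.ofReal_cos, Complex.ofReal_sin,
      ← Complex.exp_mul_I, ← Complex.exp_nat_mul]
    push_cast
    ring_nf
  have hexp : (N + 2 + w - 1 : ℂ) = 1 + (N + w) := by ring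
  simp only [hre, hpow, Complex.norm_polarCoord_symm, abs_of_pos hr, abs_mul, Complex.real_smul,
    hexp, Complex.cpow_add _ _ hr', Complex.cpow_one, Complex.cpow_natCast]
  rw [Complex.ofReal_mul, Complex.mul_cpow_ofReal_nonneg hr.le (abs_nonneg _)]
  ring

theorem absCosCoeff_even_ne_zero {w : ℂ} (hw : w.re = 0) (hw0 : w ≠ 0) (k : ℕ) :
    absCosCoeff w (2 * k : ℕ) ≠ 0 := by
  induction k with
  | zero =>
    have h := integral_gaussianComplex_abs_re_cpow_ne_zero hw
    have h2 := integral_gaussianComplex_pow_mul_abs_re_cpow w 0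
    simp only [pow_zero, one_mul] at h2
    rw [h2] at h
    exact right_ne_zero_of_mul h
  | succ k ih =>
    have h := absCosCoeff_recurrence hw (2 * k + 1 : ℕ)
    have e1 : ((2 * k + 1 : ℕ) : ℤ) + 1 = (2 * (k + 1) : ℕ) := by push_cast; ring
    have e2 : ((2 * k + 1 : ℕ) : ℤ) - 1 = (2 * k : ℕ) := by push_cast; ring
    rw [e1, e2] at h
    -- The factor is `w - 2k`; as `w` is imaginary, it could vanish only for `w = 0`.
    refine right_ne_zero_of_mul (h ▸ mul_ne_zero (fun h0 => hw0 ?_) ih)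
    have h0re := congrArg Complex.re h0
    have h0im := congrArg Complex.im h0
    simp at h0im
    exact Complex.ext hw h0im

theorem integral_gaussianComplex_pow_mul_abs_re_cpow_ne_zero {w : ℂ} (hw : w.re = 0) (hw0 : w ≠ 0)
    (k : ℕ) : ∫ z, z ^ (2 * k) * ((|z.re| : ℝ) : ℂ) ^ w ∂gaussianComplex ≠ 0 := by
  rw [integral_gaussianComplex_pow_mul_abs_re_cpow]
  refine mul_ne_zero (integral_cpow_mul_exp_neg_sq_ne_zero ?_) (absCosCoeff_even_ne_zero hw hw0 k)
  simp only [Complex.add_re, Complex.natCast_re, Complex.re_ofNat, hw]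
  positivity

/-! ### Reduction from `d` complex variables to one -/

theorem integrable_prod_pow_pi_gaussianComplex {d : ℕ} (n : Fin d → ℕ) :
    Integrable (fun z : Fin d → ℂ => ∏ j, z j ^ n j)
      (Measure.pi fun _ : Fin d => gaussianComplex) :=
  Integrable.fintype_prod (f := fun j (z : ℂ) => z ^ n j)
    fun j => integrable_pow_gaussianComplex (n j)

/-- Under a product of rotation invariant Gaussians, a function of the sum of the real parts
integrates against a holomorphic monomial as in one complex variable. -/
theorem exists_integral_pi_gaussianComplex_eq (d : ℕ) (n : Fin d → ℕ) :
    ∃ C : ℂ, C ≠ 0 ∧ ∀ g : ℝ → ℂ, Measurable g → ∀ K : ℝ, (∀ x, ‖g x‖ ≤ K) →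
      ∫ z, (∏ j, z j ^ n j) * g (∑ j, (z j).re) ∂(Measure.pi fun _ : Fin d => gaussianComplex)
        = C * ∫ z, z ^ (∑ j, n j) * g (Real.sqrt d * z.re) ∂gaussianComplex := by
  have huniv : (gaussianComplex.real Set.univ : ℂ) ≠ 0 := by
    exact_mod_cast gaussianComplex_real_univ_ne_zero
  induction d with
  | zero =>
    -- For `d = 0` both sides involve only `g 0`; the constant cancels the total mass, since the
    -- Gaussian is not normalized.
    refine ⟨(gaussianComplex.real Set.univ : ℂ)⁻¹, inv_ne_zero huniv, fun g _ K _ => ?_⟩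
    have hpi : (Measure.pi fun _ : Fin 0 => gaussianComplex).real Set.univ = 1 := by
      simp [measureReal_def]
    simp [huniv, hpi]
  | succ d ih =>
    obtain ⟨C, hC, h⟩ := ih fun j => n j.succ
    have hd : (0 : ℝ) < d + 1 := by positivity
    have hsq : 0 < Real.sqrt (d + 1 : ℝ) := Real.sqrt_pos.mpr hd
    have hsqc : (Real.sqrt (d + 1 : ℝ) : ℂ) ≠ 0 := by exact_mod_cast hsq.ne'
    -- Chosen so that `x + √d y = √(d+1) (a x + b y)` with `a² + b² = 1`.
    set a : ℝ := (Real.sqrt (d + 1 : ℝ))⁻¹ with ha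
    set b : ℝ := Real.sqrt d / Real.sqrt (d + 1 : ℝ) with hb
    have hab : a ^ 2 + b ^ 2 = 1 := by
      rw [ha, hb, inv_pow, div_pow, Real.sq_sqrt hd.le, Real.sq_sqrt d.cast_nonneg]
      field_simp
      ring
    have ha0 : (a : ℂ) ≠ 0 := Complex.ofReal_ne_zero.mpr (inv_pos.mpr hsq).ne'
    have hb0 : (b : ℂ) ^ (∑ j : Fin d, n j.succ) ≠ 0 := by
      -- For `d = 0` one has `b = 0`, but the exponent is an empty sum.
      rcases Nat.eq_zero_or_pos d with rfl | hd0
      · simp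
      · refine pow_ne_zero _ ?_
        have : 0 < b := div_pos (Real.sqrt_pos.mpr (by exact_mod_cast hd0)) hsq
        exact_mod_cast this.ne'
    refine ⟨C * (gaussianComplex.real Set.univ * a ^ n 0 * b ^ (∑ j : Fin d, n j.succ)),
      mul_ne_zero hC (mul_ne_zero (mul_ne_zero huniv (pow_ne_zero _ ha0)) hb0),
      fun g hg K hK => ?_⟩
    have hmp := measurePreserving_piFinSuccAbove (fun _ : Fin (d + 1) => gaussianComplex) 0
    have hint : Integrable (fun p : ℂ × (Fin d → ℂ) =>
        p.1 ^ n 0 * (∏ j, p.2 j ^ n j.succ) * g (p.1.re + ∑ j, (p.2 j).re))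
        (gaussianComplex.prod (Measure.pi fun _ : Fin d => gaussianComplex)) := by
      refine Integrable.mul_bdd (c := K)
        ((integrable_pow_gaussianComplex (n 0)).mul_prod
          (integrable_prod_pow_pi_gaussianComplex fun j => n j.succ))
        (Measurable.aestronglyMeasurable (by fun_prop))
        (Filter.Eventually.of_forall fun p => hK _)
    have hint2 : Integrable (fun p : ℂ × ℂ =>
        p.1 ^ n 0 * p.2 ^ (∑ j : Fin d, n j.succ) * g (p.1.re + Real.sqrt d * p.2.re))
        (gaussianComplex.prod gaussianComplex) := by
      refine Integrable.mul_bdd (c := K)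
        ((integrable_pow_gaussianComplex (n 0)).mul_prod (integrable_pow_gaussianComplex _))
        (Measurable.aestronglyMeasurable (by fun_prop))
        (Filter.Eventually.of_forall fun p => hK _)
    have hinner (z : ℂ) : ∫ y : Fin d → ℂ,
          z ^ n 0 * (∏ j, y j ^ n j.succ) * g (z.re + ∑ j, (y j).re)
            ∂(Measure.pi fun _ : Fin d => gaussianComplex)
        = C * ∫ y, z ^ n 0 * y ^ (∑ j : Fin d, n j.succ) * g (z.re + Real.sqrt d * y.re)
            ∂gaussianComplex := by
      have := h (fun x => g (z.re + x)) (by fun_prop) K fun x => hK _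
      simp only [mul_assoc, integral_const_mul, this]
      ring
    have hlin (p : ℂ × ℂ) : p.1.re + Real.sqrt d * p.2.re
        = Real.sqrt (d + 1 : ℝ) * (a * p.1.re + b * p.2.re) := by
      rw [ha, hb]
      field_simp
    calc ∫ z, (∏ j, z j ^ n j) * g (∑ j, (z j).re)
          ∂(Measure.pi fun _ : Fin (d + 1) => gaussianComplex)
        = ∫ p : ℂ × (Fin d → ℂ), p.1 ^ n 0 * (∏ j, p.2 j ^ n j.succ) *
            g (p.1.re + ∑ j, (p.2 j).re)
            ∂gaussianComplex.prod (Measure.pi fun _ : Fin d => gaussianComplex) := by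
          rw [← hmp.integral_comp']
          refine integral_congr_ae (Filter.Eventually.of_forall fun z => ?_)
          simp only [Fin.prod_univ_succ, Fin.sum_univ_succ]
          rfl
      _ = C * ∫ p : ℂ × ℂ, p.1 ^ n 0 * p.2 ^ (∑ j : Fin d, n j.succ) *
            g (p.1.re + Real.sqrt d * p.2.re) ∂gaussianComplex.prod gaussianComplex := by
          rw [integral_prod _ hint, integral_prod _ hint2]
          simp only [hinner, integral_const_mul]
      _ = _ := by
          simp only [hlin]
          rw [integral_prod_gaussianComplex_pow_mul_pow hab _ _
            (g := fun x => g (Real.sqrt (d + 1 : ℝ) * x)) (by fun_prop) fun x => hK _]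
          rw [Fin.sum_univ_succ]
          push_cast
          ring

/-! ### Nonvanishing of the Gaussian integral -/

/-- At `x = 0` the convention `ln 0 = 0` gives phase `1`, while `0^w = 0` for `w ≠ 0`; the
discrepancy lives on this null line. -/
theorem ae_gaussianComplex_re_ne_zero : ∀ᵐ z ∂gaussianComplex, z.re ≠ 0 := by
  refine (withDensity_absolutelyContinuous _ _).ae_le ?_
  have h := Measure.addHaar_submodule (volume : Measure ℂ) (LinearMap.ker Complex.reLm)
    (fun htop => by
      have : (1 : ℂ) ∈ LinearMap.ker Complex.reLm := htop ▸ Submodule.mem_top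
      simp at this)
  have hset : {z : ℂ | ¬ z.re ≠ 0} = LinearMap.ker Complex.reLm := by
    ext z
    simp
  exact ae_iff.mpr (hset ▸ h)

/-- `exp (i s ln |x|)`. -/
noncomputable def logPhase (s x : ℝ) : ℂ := Complex.exp ((s * Real.log |x| : ℝ) * Complex.I)

theorem norm_logPhase (s x : ℝ) : ‖logPhase s x‖ = 1 := Complex.norm_exp_ofReal_mul_I _

theorem measurable_logPhase (s : ℝ) : Measurable (logPhase s) := by
  unfold logPhase
  fun_prop

theorem logPhase_mul (s : ℝ) {x y : ℝ} (hx : x ≠ 0) (hy : y ≠ 0) :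
    logPhase s (x * y) = logPhase s x * logPhase s y := by
  rw [logPhase, logPhase, logPhase, ← Complex.exp_add, abs_mul,
    Real.log_mul (abs_ne_zero.mpr hx) (abs_ne_zero.mpr hy)]
  push_cast
  ring_nf

theorem logPhase_eq_cpow (s : ℝ) {x : ℝ} (hx : x ≠ 0) :
    logPhase s x = ((|x| : ℝ) : ℂ) ^ (s * Complex.I) := by
  rw [logPhase, Complex.cpow_def_of_ne_zero (by exact_mod_cast abs_ne_zero.mpr hx),
    ← Complex.ofReal_log (abs_nonneg x)]
  push_cast
  ring_nf

theorem integral_pi_gaussianComplex_logPhase_ne_zero {d : ℕ} (hd : d ≠ 0) (n : Fin d → ℕ)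
    (hn : ∀ j, Even (n j)) {s : ℝ} (hs : s ≠ 0) :
    ∫ z, (∏ j, z j ^ n j) * logPhase s (∑ j, (z j).re)
      ∂(Measure.pi fun _ : Fin d => gaussianComplex) ≠ 0 := by
  obtain ⟨C, hC, h⟩ := exists_integral_pi_gaussianComplex_eq d n
  rw [h _ (measurable_logPhase s) 1 fun x => (norm_logPhase s x).le]
  refine mul_ne_zero hC ?_
  obtain ⟨k, hk⟩ := (Finset.even_sum _ fun j (_ : j ∈ Finset.univ) => hn j).two_dvd
  have hsq : Real.sqrt d ≠ 0 := (Real.sqrt_pos.mpr (by exact_mod_cast Nat.pos_of_ne_zero hd)).ne'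
  have : ∫ z, z ^ (∑ j, n j) * logPhase s (Real.sqrt d * z.re) ∂gaussianComplex
      = logPhase s (Real.sqrt d) *
        ∫ z, z ^ (2 * k) * ((|z.re| : ℝ) : ℂ) ^ (s * Complex.I) ∂gaussianComplex := by
    rw [← integral_const_mul]
    refine integral_congr_ae ?_
    filter_upwards [ae_gaussianComplex_re_ne_zero] with z hz
    rw [logPhase_mul s hsq hz, logPhase_eq_cpow s hz, hk]
    ring
  rw [this]
  exact mul_ne_zero (Complex.exp_ne_zero _)
    (integral_gaussianComplex_pow_mul_abs_re_cpow_ne_zero (by simp) (by simpa using hs) k)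

/-! ### Fourier coefficients of the push-forward -/

theorem circleCos_eq_re_toCircle (t : UnitAddCircle) :
    circleCos t = (AddCircle.toCircle t : ℂ).re := by
  induction t using QuotientAddGroup.induction_on with
  | H x =>
    rw [circleCos_coe, AddCircle.toCircle_apply_mk, Circle.coe_exp, Complex.exp_ofReal_mul_I_re]
    simp

theorem circleCos_neg (t : UnitAddCircle) : circleCos (-t) = circleCos t := by
  rw [circleCos_eq_re_toCircle, circleCos_eq_re_toCircle, AddCircle.toCircle_neg,
    Circle.coe_inv_eq_conj, Complex.conj_re]

theorem Complex.exists_eq_norm_mul_toCircle (z : ℂ) :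
    ∃ θ : UnitAddCircle, z = ‖z‖ * (AddCircle.toCircle θ : ℂ) := by
  refine ⟨((z.arg / (2 * Real.pi) : ℝ) : UnitAddCircle), ?_⟩
  have : 2 * Real.pi / 1 * (z.arg / (2 * Real.pi)) = z.arg := by field_simp
  rw [AddCircle.toCircle_apply_mk, this, Circle.coe_exp, Complex.norm_mul_exp_arg_mul_I]

theorem re_toCircle_zsmul_mul {σ : ℤ} (hσ : σ = 1 ∨ σ = -1) (t θ : UnitAddCircle) (r : ℝ) :
    ((AddCircle.toCircle (σ • t) : ℂ) * (r * (AddCircle.toCircle θ : ℂ))).re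
      = r * circleCos (σ • θ + t) := by
  have h : ((AddCircle.toCircle (σ • t) : ℂ) * (r * (AddCircle.toCircle θ : ℂ))).re
      = r * circleCos (σ • t + θ) := by
    rw [circleCos_eq_re_toCircle, AddCircle.toCircle_add, Circle.coe_mul, mul_left_comm,
      Complex.re_ofReal_mul]
  rw [h]
  rcases hσ with rfl | rfl
  · rw [one_zsmul, one_zsmul, add_comm]
  · rw [← circleCos_neg]
    congr 2
    simp only [neg_smul, one_smul]
    abel

theorem integral_fourier_eq_zero {n : ℤ} (hn : n ≠ 0) :
    ∫ t : UnitAddCircle, fourier n t = 0 := by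
  have h := integral_add_right_eq_self (μ := (volume : Measure UnitAddCircle))
    (fun t => fourier n t) ((1 / 2 / n : ℝ) : UnitAddCircle)
  simp only [fourier_add_half_inv_index hn one_pos, integral_neg] at h
  exact self_eq_neg.mp h.symm

/-- The second character, rather than the first, makes every exponent `2 p_j` even; odd Fourier
coefficients of `|cos θ|^w` vanish under `θ ↦ θ + π`. -/
theorem fourier_two_logCosMap {d : ℕ} (p : Fin d → ℤ) (β : ℝ) (u : Fin d → ℝ)
    (t : UnitAddTorus (Fin d)) :
    fourier 2 (logCosMap p β u t) = (∏ j, fourier (2 * p j) (t j)) *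
      logPhase (4 * Real.pi * β) (∑ j, u j * circleCos (t j)) := by
  have h1 : (fourier 2 (((β * Real.log |∑ j, u j * circleCos (t j)| : ℝ)) : UnitAddCircle) : ℂ)
      = logPhase (4 * Real.pi * β) (∑ j, u j * circleCos (t j)) := by
    rw [fourier_coe_apply, logPhase]
    push_cast
    ring_nf
  have h2 : (AddCircle.toCircle (∑ j, (2 * p j) • t j) : ℂ) = ∏ j, fourier (2 * p j) (t j) := by
    simp only [fourier_apply]
    exact map_prod (Circle.coeHom.comp (AddCircle.toCircle_addChar (T := 1)).toMonoidHom)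
      (fun j => Multiplicative.ofAdd ((2 * p j) • t j)) Finset.univ
  rw [← h1, ← h2, fourier_apply, fourier_apply, logCosMap, smul_add, AddCircle.toCircle_add,
    Circle.coe_mul, Finset.smul_sum]
  simp only [mul_smul]

theorem integral_logPhase_eq_zero_of_map_eq {d : ℕ} {p : Fin d → ℤ} {β : ℝ} {u : Fin d → ℝ}
    (h : Measure.map (logCosMap p β u) (volume : Measure (UnitAddTorus (Fin d))) = volume) :
    ∫ t : UnitAddTorus (Fin d), (∏ j, fourier (2 * p j) (t j)) *
      logPhase (4 * Real.pi * β) (∑ j, u j * circleCos (t j)) = 0 := by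
  have := integral_fourier_eq_zero (n := 2) two_ne_zero
  rw [← h, integral_map (measurable_logCosMap p β u).aemeasurable
    (fourier 2).continuous.measurable.aestronglyMeasurable] at this
  simpa only [fourier_two_logCosMap] using this

/-! ### Averaging over the torus action, and conclusion -/

/-- Let the torus rotate the coordinates of `z`. Averaging over the torus first gives zero by
hypothesis; integrating over `z` first gives the Gaussian integral, by invariance. Fubini equates
the two. -/
theorem integral_pi_gaussianComplex_eq_zero_of_forall {d : ℕ} {p : Fin d → ℤ} {s : ℝ}
    (h : ∀ u : Fin d → ℝ, ∫ t : UnitAddTorus (Fin d), (∏ j, fourier (2 * p j) (t j)) *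
      logPhase s (∑ j, u j * circleCos (t j)) = 0) :
    ∫ z, (∏ j, z j ^ (2 * (p j).natAbs)) * logPhase s (∑ j, (z j).re)
      ∂(Measure.pi fun _ : Fin d => gaussianComplex) = 0 := by
  -- Only nonnegative powers of `z_j` are polynomial, so the sign of `p_j` is moved into the
  -- direction of rotation; this is harmless because the cosine is even.
  have hσ : ∀ j, ∃ σ : ℤ, (σ = 1 ∨ σ = -1) ∧ (p j).natAbs * σ = p j := fun j => by
    rcases Int.natAbs_eq (p j) with hp | hp
    · exact ⟨1, Or.inl rfl, by rw [mul_one, ← hp]⟩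
    · exact ⟨-1, Or.inr rfl, by rw [mul_neg_one, ← hp]⟩
  choose σ hσ hσp using hσ
  set γ := Measure.pi fun _ : Fin d => gaussianComplex
  let A : UnitAddTorus (Fin d) → (Fin d → ℂ) → Fin d → ℂ :=
    fun t z j => (AddCircle.toCircle (σ j • t j) : ℂ) * z j
  let H : (Fin d → ℂ) → ℂ := fun z =>
    (∏ j, z j ^ (2 * (p j).natAbs)) * logPhase s (∑ j, (z j).re)
  have hlm := measurable_logPhase s
  have hH : Measurable H := by fun_prop
  have hcirc : Continuous fun t : UnitAddCircle => (AddCircle.toCircle t : ℂ) :=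
    continuous_subtype_val.comp AddCircle.continuous_toCircle
  have hA : Measurable (Function.uncurry A) := by
    refine Continuous.measurable (continuous_pi fun j => ?_)
    exact (hcirc.comp (by fun_prop : Continuous fun q : UnitAddTorus (Fin d) × (Fin d → ℂ) =>
      σ j • q.1 j)).mul (by fun_prop)
  have hpow (t : UnitAddTorus (Fin d)) (z : Fin d → ℂ) : ∏ j, A t z j ^ (2 * (p j).natAbs)
      = (∏ j, z j ^ (2 * (p j).natAbs)) * ∏ j, fourier (2 * p j) (t j) := by
    rw [← Finset.prod_mul_distrib]
    refine Finset.prod_congr rfl fun j _ => ?_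
    have : (2 * (p j).natAbs) • σ j • t j = (2 * p j) • t j := by
      rw [← natCast_zsmul, ← mul_smul]
      congr 1
      push_cast
      rw [mul_assoc, ← Int.natCast_natAbs, hσp]
    rw [mul_pow, ← Circle.coe_pow, ← AddCircle.toCircle_nsmul, this, fourier_apply, mul_comm]
  have hinv (t : UnitAddTorus (Fin d)) : ∫ z, H (A t z) ∂γ = ∫ z, H z ∂γ := by
    have hmp : MeasurePreserving (A t) γ γ :=
      measurePreserving_pi _ _ fun j => measurePreserving_mul_gaussianComplex _
    have := integral_map hmp.measurable.aemeasurable (μ := γ) hH.aestronglyMeasurable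
    rw [hmp.map_eq] at this
    exact this.symm
  have hzero (z : Fin d → ℂ) : ∫ t, H (A t z) = 0 := by
    choose θ hθ using fun j => (z j).exists_eq_norm_mul_toCircle
    have hre (t : UnitAddTorus (Fin d)) : ∑ j, (A t z j).re
        = ∑ j, ‖z j‖ * circleCos (((fun j => σ j • θ j) + t) j) := by
      refine Finset.sum_congr rfl fun j _ => ?_
      simp only [A]
      rw [Pi.add_apply, ← re_toCircle_zsmul_mul (hσ j), ← hθ j]
    have hfour (t : UnitAddTorus (Fin d)) : ∏ j, (fourier (2 * p j) (t j) : ℂ)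
        = (∏ j, (fourier (2 * p j) (-(σ j • θ j)) : ℂ)) *
          ∏ j, fourier (2 * p j) (((fun j => σ j • θ j) + t) j) := by
      rw [← Finset.prod_mul_distrib]
      refine Finset.prod_congr rfl fun j _ => ?_
      rw [fourier_apply, fourier_apply, fourier_apply, ← Circle.coe_mul, ← AddCircle.toCircle_add,
        ← smul_add, Pi.add_apply, neg_add_cancel_left]
    have hHA (t : UnitAddTorus (Fin d)) : H (A t z) = (∏ j, z j ^ (2 * (p j).natAbs)) *
        (∏ j, (fourier (2 * p j) (-(σ j • θ j)) : ℂ)) *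
          ((∏ j, fourier (2 * p j) (((fun j => σ j • θ j) + t) j)) *
            logPhase s (∑ j, ‖z j‖ * circleCos (((fun j => σ j • θ j) + t) j))) := by
      simp only [H]
      rw [hpow, hre, hfour]
      ring
    -- The moduli of the `z_j` serve as `u`; their arguments are absorbed by a translation of Haar
    -- measure.
    have h0 := h fun j => ‖z j‖
    rw [← integral_add_left_eq_self _ (fun j => σ j • θ j)] at h0
    simp only [hHA, integral_const_mul, h0, mul_zero]
  have hint : Integrable (Function.uncurry fun t z => H (A t z))
      ((volume : Measure (UnitAddTorus (Fin d))).prod γ) := by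
    refine ((integrable_prod_pow_pi_gaussianComplex fun j => 2 * (p j).natAbs).norm.comp_snd
      (volume : Measure (UnitAddTorus (Fin d)))).mono' (hH.comp hA).aestronglyMeasurable
      (Filter.Eventually.of_forall fun q => ?_)
    simp only [Function.uncurry, H, hpow, norm_mul, norm_logPhase, norm_prod, fourier_apply,
      Circle.norm_coe, Finset.prod_const_one, mul_one, le_refl]
  have hswap := integral_integral_swap hint
  have hvol : (volume : Measure (UnitAddTorus (Fin d))).real Set.univ = 1 := by
    rw [measureReal_def, volume_pi, Measure.pi_univ]
    simp
  simpa only [hinv, hzero, integral_const, integral_zero, hvol, one_smul, smul_zero] using hswap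

theorem theoremA6 (d : ℕ) (hd : 1 ≤ d) (p : Fin d → ℤ) (β : ℝ) (hβ : β ≠ 0) :
    ∃ u : Fin d → ℝ,
      Measure.map (logCosMap p β u) (volume : Measure (UnitAddTorus (Fin d))) ≠
        (volume : Measure UnitAddCircle) := by
  by_contra! hall
  exact integral_pi_gaussianComplex_logPhase_ne_zero (Nat.one_le_iff_ne_zero.mp hd)
    (fun j => 2 * (p j).natAbs) (fun j => even_two_mul _)
    (mul_ne_zero (mul_ne_zero four_ne_zero Real.pi_ne_zero) hβ)
    (integral_pi_gaussianComplex_eq_zero_of_forall fun u =>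
      integral_logPhase_eq_zero_of_map_eq (hall u))
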